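/- Let $\alpha_1,\alpha_2,\alpha_3,\beta$ be real numbers with $\alpha_a>-1$ for all $a$, $\alpha_a-\alpha_b\notin\mathbb Z$ for $a\neq b$, $\alpha_2>0$ and $\beta>0$, and let $\xi_0,\xi_1$ be scalars in $\mathbb K=\mathbb R$ or $\mathbb C$. Consider the Jacobi–Piñeiro measures $\mathrm d\mu_a(x)=x^{\alpha_a}(1-x)^\beta\,\mathrm dx$ on $[0,1]$, $a=1,2,3$, and the perturbed row of measures \[ \mathrm d\check\mu=\Big(x^{\alpha_2-1}(1-x)^\beta\,\mathrm dx+\xi_0\,\delta_0,\;\; x^{\alpha_3}(1-x)^{\beta-1}\,\mathrm dx+\xi_1\,\delta_1,\;\; x^{\alpha_1}(1-x)^\beta\,\mathrm dx\Big), \] which satisfies $\mathrm d\check\mu\,R=(\mathrm d\mu_1,\mathrm d\mu_2,\mathrm d\mu_3)$ for $R(x)=\begin{bmatrix}0&x&0\\0&0&1-x\\1&0&0\end{bmatrix}$. For a row $\nu=(\nu_1,\nu_2,\nu_3)$ of measures, the moment matrix has the entries $\int x^{i+m}\,\mathrm d\nu_a$ in row $i$ and column $3m+a-1$ ($i,m\ge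 0$, $a\in\{1,2,3\}$). If all its leading principal minors are nonzero (one says that the orthogonality exists), then for each $n\ge 0$ there are a unique monic polynomial $B_n$ of degree $n$ (type II) with $\int B_n(x)x^l\,\mathrm d\nu_a=0$ whenever $3l+a-1<n$, and a unique vector of polynomials $(A_n^{(1)},A_n^{(2)},A_n^{(3)})$ (type I), where $x^m$ may occur in $A_n^{(a)}$ only if $3m+a-1\le n$, with $\int x^l\sum_a A_n^{(a)}(x)\,\mathrm d\nu_a=\delta_{l,n}$ for $0\le l\le n$. Write $P_n$, $P_n^{(a)}$ for these polynomials for $\nu=\mu$ (the Jacobi–Piñeiro polynomials) and $\check P_n$, $\check P_n^{(a)}$ for $\nu=\check\mu$. Put $D_n^{(a)}(z)=\int_0^1\frac{P_n(x)}{z-x}\,\mathrm d\mu_a(x)$, \[ d_n^0=D_n^{(2)}(0)-P_n(0)\,\xi_0,\qquad d_n^1=D_n^{(3)}(1)+P_n(1)\,\xi_1,\qquad \tau_n=\begin{vmatrix}d_{n-1}^0&d_{n-1}^1\\ d_n^0&d_n^1\end{vmatrix}\quad(n\ge1). \] Proposition. Assume that the orthogonality exists for $\check\mu$. Then $\tau_n\neq0$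 for all $n\ge1$, and for all $n>1$ and all $x\in\mathbb K$ \[ \begin{bmatrix}\check P_n^{(1)}(x)\\ \check P_n^{(2)}(x)\\ \check P_n^{(3)}(x)\end{bmatrix} =\frac1{\tau_n}\sum_{i=0}^{n-2}\begin{vmatrix}d_i^0&d_i^1\\ d_{n-1}^0&d_{n-1}^1\end{vmatrix} \begin{bmatrix}x\,P_i^{(2)}(x)\\(1-x)\,P_i^{(3)}(x)\\P_i^{(1)}(x)\end{bmatrix} +\frac1{\tau_n}\begin{bmatrix}d_{n-1}^1\\ d_{n-1}^0\\0\end{bmatrix}, \qquad \check P_n(x)=\frac1{\tau_{n-1}}\begin{vmatrix}d_{n-2}^0&d_{n-2}^1&P_{n-2}(x)\\ d_{n-1}^0&d_{n-1}^1&P_{n-1}(x)\\ d_n^0&d_n^1&P_n(x)\end{vmatrix}. \] -/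

import Mathlib

open Polynomial

namespace JacobiPineiro

noncomputable section

/-! Multiple orthogonality on the step line for a row `(dν₁, dν₂, dν₃)` of three measures on the
line. The row enters through its integration functionals `L a p = ∫ p dν_{a+1}` (`a : Fin 3`),
defined on polynomials over `𝕜 = ℝ` or `𝕜 = ℂ`. -/

section StepLine

variable {𝕜 : Type*} [Field 𝕜]

/-- The moment matrix `∫ X_{[1]}(x) dν(x) X_{[3]}(x)ᵀ`: its column `j = 3 m + a` belongs to the
monomial `x ^ m` and to the measure with index `a`. -/
def momentMatrix (L : Fin 3 → 𝕜[X] → 𝕜) (i j : ℕ) : 𝕜 :=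
  L (Fin.ofNat 3 j) (X ^ i * X ^ (j / 3))

/-- The orthogonality exists: all leading principal minors of the moment matrix are nonzero
(equivalently, the moment matrix has an `LU` factorization). -/
def HasOrthogonality (L : Fin 3 → 𝕜[X] → 𝕜) : Prop :=
  ∀ k : ℕ, (Matrix.of fun i j : Fin k => momentMatrix L i j).det ≠ 0

/-- `B` is a type II orthogonal polynomial of index `n`: it is monic of degree `n`, and the row
`∫ B dν X_{[3]}ᵀ` vanishes in all columns `j = 3 l + a < n`. -/
def IsTypeII (L : Fin 3 → 𝕜[X] → 𝕜) (n : ℕ) (B : 𝕜[X]) : Prop :=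
  B.Monic ∧ B.natDegree = n ∧
    ∀ (a : Fin 3) (l : ℕ), 3 * l + (a : ℕ) < n → L a (B * X ^ l) = 0

/-- `A = (A⁽¹⁾, A⁽²⁾, A⁽³⁾)` is a type I orthogonal vector of index `n`: the monomial `x ^ m` may
occur in the entry `a` only if `3 m + a ≤ n`, and `∫ x ^ l ∑ₐ dνₐ A⁽ᵃ⁾` is `0` for `l < n` and
`1` for `l = n`. -/
def IsTypeI (L : Fin 3 → 𝕜[X] → 𝕜) (n : ℕ) (A : Fin 3 → 𝕜[X]) : Prop :=
  (∀ (a : Fin 3) (m : ℕ), n < 3 * m + (a : ℕ) → (A a).coeff m = 0) ∧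
    ∀ l : ℕ, l ≤ n → ∑ a, L a (X ^ l * A a) = if l = n then 1 else 0

open Classical in
/-- The type II polynomial of index `n`. It exists and is unique if the orthogonality exists. -/
def typeII (L : Fin 3 → 𝕜[X] → 𝕜) (n : ℕ) : 𝕜[X] :=
  if h : ∃ B, IsTypeII L n B then h.choose else 0

open Classical in
/-- The type I vector of index `n`. It exists and is unique if the orthogonality exists. -/
def typeI (L : Fin 3 → 𝕜[X] → 𝕜) (n : ℕ) : Fin 3 → 𝕜[X] :=
  if h : ∃ A, IsTypeI L n A then h.choose else 0

end StepLine

section Measures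

variable {𝕜 : Type*} [RCLike 𝕜]

/-- Integration of polynomials against the Jacobi weight `x ^ s (1 - x) ^ t dx` on `[0, 1]`. -/
def jacobiIntegral (s t : ℝ) (p : 𝕜[X]) : 𝕜 :=
  ∫ x in (0 : ℝ)..1, ((x ^ s * (1 - x) ^ t : ℝ) : 𝕜) * p.eval (x : 𝕜)

/-- The Jacobi–Piñeiro measures `dμₐ = x ^ αₐ (1 - x) ^ β dx` on `[0, 1]`. -/
def jpMeasure (α : Fin 3 → ℝ) (β : ℝ) (a : Fin 3) (p : 𝕜[X]) : 𝕜 :=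
  jacobiIntegral (α a) β p

/-- The matrix polynomial `R(x)` of the perturbation. -/
def perturbationMatrix (𝕜 : Type*) [RCLike 𝕜] : Matrix (Fin 3) (Fin 3) 𝕜[X] :=
  !![0, X, 0;
     0, 0, 1 - X;
     1, 0, 0]

/-- The perturbed measures
`(x ^ (α₂ - 1) (1 - x) ^ β dx + ξ₀ δ₀, x ^ α₃ (1 - x) ^ (β - 1) dx + ξ₁ δ₁, x ^ α₁ (1 - x) ^ β dx)`. -/
def perturbedMeasure (α : Fin 3 → ℝ) (β : ℝ) (ξ₀ ξ₁ : 𝕜) : Fin 3 → 𝕜[X] → 𝕜 :=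
  ![fun p => jacobiIntegral (α 1 - 1) β p + ξ₀ * p.eval 0,
    fun p => jacobiIntegral (α 2) (β - 1) p + ξ₁ * p.eval 1,
    fun p => jacobiIntegral (α 0) β p]

/-- The perturbed measures satisfy `dμ̌(x) R(x) = dμ(x)`. -/
theorem perturbedMeasure_mul_perturbationMatrix (α : Fin 3 → ℝ) (β : ℝ) (ξ₀ ξ₁ : 𝕜)
    (b : Fin 3) (p : 𝕜[X]) :
    ∑ a, perturbedMeasure α β ξ₀ ξ₁ a (perturbationMatrix 𝕜 a b * p) = jpMeasure α β b p := by
  have h0 : ∀ s t : ℝ, jacobiIntegral s t (0 : 𝕜[X]) = 0 := fun s t => by simp [jacobiIntegral]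
  have hx : jacobiIntegral (α 1 - 1) β (X * p) = jacobiIntegral (α 1) β p := by
    unfold jacobiIntegral
    rw [intervalIntegral.integral_of_le zero_le_one, intervalIntegral.integral_of_le zero_le_one]
    refine MeasureTheory.setIntegral_congr_fun measurableSet_Ioc fun x hx => ?_
    have : x ^ α 1 = x ^ (α 1 - 1) * x := by
      rw [Real.rpow_sub_one hx.1.ne', div_mul_cancel₀ _ hx.1.ne']
    simp only [eval_mul, eval_X, this]
    push_cast
    ring
  have hy : jacobiIntegral (α 2) (β - 1) ((1 - X) * p) = jacobiIntegral (α 2) β p := by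
    unfold jacobiIntegral
    rw [intervalIntegral.integral_of_le zero_le_one, intervalIntegral.integral_of_le zero_le_one,
      MeasureTheory.integral_Ioc_eq_integral_Ioo, MeasureTheory.integral_Ioc_eq_integral_Ioo]
    refine MeasureTheory.setIntegral_congr_fun measurableSet_Ioo fun x hx => ?_
    have h1 : (1 - x) ≠ 0 := (sub_pos.2 hx.2).ne'
    have : (1 - x) ^ β = (1 - x) ^ (β - 1) * (1 - x) := by
      rw [Real.rpow_sub_one h1, div_mul_cancel₀ _ h1]
    simp only [eval_mul, eval_sub, eval_one, eval_X, this]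
    push_cast
    ring
  fin_cases b <;>
    simp [Fin.sum_univ_three, perturbedMeasure, perturbationMatrix, jpMeasure, h0, hx, hy]

/-- The Jacobi–Piñeiro type II polynomial `P_n`. -/
def P (𝕜 : Type*) [RCLike 𝕜] (α : Fin 3 → ℝ) (β : ℝ) (n : ℕ) : 𝕜[X] :=
  typeII (jpMeasure α β) n

/-- The Jacobi–Piñeiro type I vector `(P_n⁽¹⁾, P_n⁽²⁾, P_n⁽³⁾)`. -/
def PI (𝕜 : Type*) [RCLike 𝕜] (α : Fin 3 → ℝ) (β : ℝ) (n : ℕ) : Fin 3 → 𝕜[X] :=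
  typeI (jpMeasure α β) n

/-- The Cauchy transform `D_n⁽ᵃ⁾(z) = ∫ P_n(x) dμₐ(x) / (z - x)`. -/
def D (α : Fin 3 → ℝ) (β : ℝ) (n : ℕ) (a : Fin 3) (z : 𝕜) : 𝕜 :=
  ∫ x in (0 : ℝ)..1,
    (P 𝕜 α β n).eval (x : 𝕜) * ((x ^ α a * (1 - x) ^ β : ℝ) : 𝕜) / (z - (x : 𝕜))

/-- The entry `D_n⁽²⁾(0) - P_n(0) ξ₀` of the `τ`-determinants. -/
def d₀ (α : Fin 3 → ℝ) (β : ℝ) (ξ₀ : 𝕜) (n : ℕ) : 𝕜 :=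
  D α β n 1 0 - (P 𝕜 α β n).eval 0 * ξ₀

/-- The entry `D_n⁽³⁾(1) + P_n(1) ξ₁` of the `τ`-determinants. The sign of the mass is opposite to
that in `d₀`: with the eigenvectors of `R` at `0` and `1` one has `v^L R'(0) v^R = 1` and
`v^L R'(1) v^R = -1`. -/
def d₁ (α : Fin 3 → ℝ) (β : ℝ) (ξ₁ : 𝕜) (n : ℕ) : 𝕜 :=
  D α β n 2 1 + (P 𝕜 α β n).eval 1 * ξ₁

/-- The determinant `τ_n`, for `n ≥ 1`. -/
def τ (α : Fin 3 → ℝ) (β : ℝ) (ξ₀ ξ₁ : 𝕜) (n : ℕ) : 𝕜 :=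
  Matrix.det !![d₀ α β ξ₀ (n - 1), d₁ α β ξ₁ (n - 1);
                d₀ α β ξ₀ n, d₁ α β ξ₁ n]

end Measures

end

end JacobiPineiro

/-! Write `L` for the functionals of the perturbed row and `M` for those of the Jacobi–Piñeiro row.
The relation through R reads M₁ = L₃, M₂ = L₁(x·), M₃ = L₂((1-x)·). In the step-line order each of
these moves a column of `M` two places to the right, so orthogonality to the first n columns of `L`
follows from orthogonality to the first n-2 columns of `M` together with L₁p = L₂p = 0. Since d⁰ₙ =
-L₁Pₙ and d¹ₙ = L₂Pₙ, the τ's are determinants of these two extra conditions (`d₀_eq`, `d₁_eq`).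

If τ vanished, a nontrivial combination of two consecutive Pₖ would be orthogonal to too many
columns for its degree (`det_ne_zero`). The new type II polynomial is the combination of three
consecutive Pₖ killed by L₁ and L₂, hence a 3 × 3 determinant (`typeII_mul_det`). The type I vector
is found by testing an ansatz on the Pₖ and using biorthogonality (`typeI_eq`).

Orthogonality for `M` is not assumed: its moments are Beta values, and their linear independence
reduces to a polynomial with too many zeros (`hasOrthogonality_jpMeasure`). -/

namespace JacobiPineiro
-- Existence, uniqueness and biorthogonality on the step line.
section StepLineTheory

variable {𝕜 : Type*} [Field 𝕜] {L : Fin 3 → 𝕜[X] → 𝕜}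

/-- The functionals of the first `n` columns of the moment matrix vanish on `p`. -/
def StepOrthogonal (L : Fin 3 → 𝕜[X] → 𝕜) (n : ℕ) (p : 𝕜[X]) : Prop :=
  ∀ (a : Fin 3) (l : ℕ), 3 * l + (a : ℕ) < n → L a (p * X ^ l) = 0

theorem map_sum_C_mul (hL : ∀ a, IsLinearMap 𝕜 (L a)) {ι : Type*} (s : Finset ι) (c : ι → 𝕜)
    (f : ι → 𝕜[X]) (a : Fin 3) : L a (∑ i ∈ s, C (c i) * f i) = ∑ i ∈ s, c i * L a (f i) := by
  simp only [← smul_eq_C_mul]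
  exact (map_sum (IsLinearMap.mk' _ (hL a)) (fun i => c i • f i) s).trans
    (Finset.sum_congr rfl fun i _ => (hL a).map_smul _ _)

theorem map_C_mul (hL : ∀ a, IsLinearMap 𝕜 (L a)) (c : 𝕜) (p : 𝕜[X]) (a : Fin 3) :
    L a (C c * p) = c * L a p := by
  rw [← smul_eq_C_mul, (hL a).map_smul, smul_eq_mul]

theorem ofNat_three_mul_add (l : ℕ) (a : Fin 3) : Fin.ofNat 3 (3 * l + a) = a := by
  ext; simp [Fin.ofNat, Nat.mod_eq_of_lt a.2]

theorem three_mul_add_div (l : ℕ) (a : Fin 3) : (3 * l + (a : ℕ)) / 3 = l := by omega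

theorem three_mul_div_add_ofNat (j : ℕ) : 3 * (j / 3) + ((Fin.ofNat 3 j : Fin 3) : ℕ) = j := by
  simp only [Fin.ofNat]; omega

theorem stepOrthogonal_iff {n : ℕ} {p : 𝕜[X]} : StepOrthogonal L n p ↔
    ∀ j < n, L (Fin.ofNat 3 j) (p * X ^ (j / 3)) = 0 := by
  constructor
  · intro h j hj
    exact h _ _ (by rwa [three_mul_div_add_ofNat])
  · intro h a l hl
    simpa only [ofNat_three_mul_add, three_mul_add_div] using h _ hl

theorem StepOrthogonal.mono {m n : ℕ} {p : 𝕜[X]} (h : StepOrthogonal L n p) (hmn : m ≤ n) :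
    StepOrthogonal L m p := fun a l hl => h a l (hl.trans_le hmn)

theorem StepOrthogonal.add (hL : ∀ a, IsLinearMap 𝕜 (L a)) {n : ℕ} {p q : 𝕜[X]}
    (hp : StepOrthogonal L n p) (hq : StepOrthogonal L n q) : StepOrthogonal L n (p + q) := by
  intro a l hl
  rw [add_mul, (hL a).map_add, hp a l hl, hq a l hl, add_zero]

theorem StepOrthogonal.C_mul (hL : ∀ a, IsLinearMap 𝕜 (L a)) {n : ℕ} {p : 𝕜[X]}
    (hp : StepOrthogonal L n p) (c : 𝕜) : StepOrthogonal L n (C c * p) := by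
  intro a l hl
  rw [mul_assoc, map_C_mul hL, hp a l hl, mul_zero]

/-- The coefficients of `p` form a left kernel vector of the leading n × n moment matrix, which is
invertible. -/
theorem eq_zero_of_stepOrthogonal (hL : ∀ a, IsLinearMap 𝕜 (L a)) (hO : HasOrthogonality L)
    {n : ℕ} {p : 𝕜[X]} (hd : p.degree < n) (hp : StepOrthogonal L n p) : p = 0 := by
  have hp' := stepOrthogonal_iff.1 hp
  have hsum : p = ∑ i : Fin n, C (p.coeff i) * X ^ (i : ℕ) := by
    rw [Fin.sum_univ_eq_sum_range (fun i => C (p.coeff i) * X ^ i)]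
    ext m
    simp only [finsetSum_coeff, coeff_C_mul_X_pow]
    by_cases hm : m < n
    · simp [hm]
    · simp [hm, coeff_eq_zero_of_degree_lt (hd.trans_le (by exact_mod_cast not_lt.1 hm))]
  have hv := Matrix.eq_zero_of_vecMul_eq_zero (hO n) (v := fun i : Fin n => p.coeff i) (by
    ext j
    rw [Pi.zero_apply, ← hp' j j.2]
    conv_rhs => rw [hsum, Finset.sum_mul]
    simp only [mul_assoc, map_sum_C_mul hL]
    rfl)
  rw [hsum]
  exact Finset.sum_eq_zero fun i _ => by simp [congrFun hv i]

theorem exists_isTypeII (hL : ∀ a, IsLinearMap 𝕜 (L a)) (hO : HasOrthogonality L) (n : ℕ) :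
    ∃ B, IsTypeII L n B := by
  set A : Matrix (Fin n) (Fin n) 𝕜 := Matrix.of fun i j : Fin n => momentMatrix L i j with hA
  have hdet : IsUnit A.det := isUnit_iff_ne_zero.2 (hO n)
  set v : Fin n → 𝕜 := Matrix.vecMul (fun j : Fin n => momentMatrix L n j) A⁻¹ with hv
  have hvA : Matrix.vecMul v A = fun j : Fin n => momentMatrix L n j := by
    rw [hv, Matrix.vecMul_vecMul, Matrix.nonsing_inv_mul _ hdet, Matrix.vecMul_one]
  have hdeg : (∑ i : Fin n, C (-v i) * X ^ (i : ℕ) : 𝕜[X]).degree < n := by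
    refine (degree_sum_le _ _).trans_lt ((Finset.sup_lt_iff (WithBot.bot_lt_coe n)).2 ?_)
    exact fun i _ => (degree_C_mul_X_pow_le _ _).trans_lt ((Nat.cast_lt (α := WithBot ℕ)).2 i.2)
  refine ⟨X ^ n + ∑ i : Fin n, C (-v i) * X ^ (i : ℕ), monic_X_pow_add hdeg,
    natDegree_eq_of_degree_eq_some ?_, stepOrthogonal_iff.2 fun j hj => ?_⟩
  · rw [degree_add_eq_left_of_degree_lt (by rwa [degree_X_pow]), degree_X_pow]
  · rw [add_mul, (hL _).map_add, Finset.sum_mul]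
    simp only [mul_assoc, map_sum_C_mul hL]
    have := congrFun hvA ⟨j, hj⟩
    simp only [Matrix.vecMul, dotProduct, hA, Matrix.of_apply, momentMatrix] at this
    simp only [neg_mul, Finset.sum_neg_distrib, this, add_neg_cancel]

theorem IsTypeII.eq (hL : ∀ a, IsLinearMap 𝕜 (L a)) (hO : HasOrthogonality L) {n : ℕ}
    {B B' : 𝕜[X]} (h : IsTypeII L n B) (h' : IsTypeII L n B') : B = B' := by
  have h0 := h'.1.ne_zero
  have hd : B.degree = n := by rw [degree_eq_natDegree h.1.ne_zero, h.2.1]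
  have hd' : B'.degree = n := by rw [degree_eq_natDegree h0, h'.2.1]
  have hlt : (B - B').degree < n := by
    rw [← hd]
    exact degree_sub_lt_left (hd.trans hd'.symm) h.1.ne_zero (h.1.trans h'.1.symm)
  rw [← sub_eq_zero]
  refine eq_zero_of_stepOrthogonal hL hO hlt ?_
  have := StepOrthogonal.add hL (show StepOrthogonal L n B from h.2.2)
    (StepOrthogonal.C_mul hL (show StepOrthogonal L n B' from h'.2.2) (-1))
  simpa [sub_eq_add_neg] using this

theorem isTypeII_typeII (hL : ∀ a, IsLinearMap 𝕜 (L a)) (hO : HasOrthogonality L) (n : ℕ) :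
    IsTypeII L n (typeII L n) := by
  have h := exists_isTypeII hL hO n
  rw [typeII, dif_pos h]
  exact h.choose_spec

/-- The vector of polynomials with the coefficient `c (3 m + a)` at `x ^ m` in the entry `a`. -/
noncomputable def stepVector (n : ℕ) (c : ℕ → 𝕜) (a : Fin 3) : 𝕜[X] :=
  ∑ j ∈ Finset.range (n + 1), if Fin.ofNat 3 j = a then C (c j) * X ^ (j / 3) else 0

theorem coeff_stepVector (n : ℕ) (c : ℕ → 𝕜) (a : Fin 3) (m : ℕ) :
    (stepVector n c a).coeff m = if 3 * m + (a : ℕ) ≤ n then c (3 * m + a) else 0 := by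
  have h : ∀ j, (if Fin.ofNat 3 j = a then C (c j) * X ^ (j / 3) else 0 : 𝕜[X]).coeff m =
      if 3 * m + (a : ℕ) = j then c j else 0 := by
    intro j
    by_cases hj : 3 * m + (a : ℕ) = j
    · subst hj
      rw [if_pos (ofNat_three_mul_add m a), if_pos rfl, three_mul_add_div]
      simp
    · rw [if_neg hj]
      split_ifs with ha
      · rw [coeff_C_mul_X_pow, if_neg]
        rintro rfl
        exact hj (by rw [← ha, three_mul_div_add_ofNat])
      · simp
  simp only [stepVector, finsetSum_coeff, h, Finset.sum_ite_eq, Finset.mem_range, Nat.lt_succ_iff]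

theorem sum_map_stepVector (hL : ∀ a, IsLinearMap 𝕜 (L a)) (n : ℕ) (c : ℕ → 𝕜) (p : 𝕜[X]) :
    ∑ a, L a (p * stepVector n c a) =
      ∑ j ∈ Finset.range (n + 1), c j * L (Fin.ofNat 3 j) (p * X ^ (j / 3)) := by
  have h : ∀ a, L a (p * stepVector n c a) = ∑ j ∈ Finset.range (n + 1),
      if Fin.ofNat 3 j = a then c j * L a (p * X ^ (j / 3)) else 0 := by
    intro a
    have : p * stepVector n c a = ∑ j ∈ Finset.range (n + 1),
        C (if Fin.ofNat 3 j = a then c j else 0) * (p * X ^ (j / 3)) := by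
      rw [stepVector, Finset.mul_sum]
      refine Finset.sum_congr rfl fun j _ => ?_
      split_ifs
      · ring
      · simp
    rw [this, map_sum_C_mul hL]
    exact Finset.sum_congr rfl fun j _ => by split_ifs <;> simp
  simp only [h]
  rw [Finset.sum_comm]
  exact Finset.sum_congr rfl fun j _ => by simp

theorem eq_stepVector {n : ℕ} {A : Fin 3 → 𝕜[X]}
    (hA : ∀ (a : Fin 3) (m : ℕ), n < 3 * m + (a : ℕ) → (A a).coeff m = 0) :
    A = stepVector n fun j => (A (Fin.ofNat 3 j)).coeff (j / 3) := by
  ext a m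
  rw [coeff_stepVector]
  split_ifs with h
  · rw [ofNat_three_mul_add, three_mul_add_div]
  · exact hA a m (not_le.1 h)

/-- The coefficients, in step-line order, are the last column of the inverse of the leading (n+1) ×
(n+1) moment matrix. -/
theorem exists_isTypeI (hL : ∀ a, IsLinearMap 𝕜 (L a)) (hO : HasOrthogonality L) (n : ℕ) :
    ∃ A, IsTypeI L n A := by
  set A : Matrix (Fin (n + 1)) (Fin (n + 1)) 𝕜 :=
    Matrix.of fun i j : Fin (n + 1) => momentMatrix L i j with hA
  have hdet : IsUnit A.det := isUnit_iff_ne_zero.2 (hO (n + 1))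
  set e : Fin (n + 1) → 𝕜 := fun l => if (l : ℕ) = n then 1 else 0 with he
  set c : Fin (n + 1) → 𝕜 := A⁻¹.mulVec e with hc
  have hAc : A.mulVec c = e := by
    rw [hc, Matrix.mulVec_mulVec, Matrix.mul_nonsing_inv _ hdet, Matrix.one_mulVec]
  refine ⟨stepVector n fun j => if h : j < n + 1 then c ⟨j, h⟩ else 0, fun a m h => ?_,
    fun l hl => ?_⟩
  · rw [coeff_stepVector, if_neg (not_le.2 h)]
  · rw [sum_map_stepVector hL, Finset.sum_range]
    have := congrFun hAc ⟨l, Nat.lt_succ_of_le hl⟩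
    simp only [Matrix.mulVec, dotProduct, hA, Matrix.of_apply, momentMatrix, he] at this
    rw [← this]
    exact Finset.sum_congr rfl fun j _ => by rw [dif_pos j.2, mul_comm]

theorem IsTypeI.eq (hL : ∀ a, IsLinearMap 𝕜 (L a)) (hO : HasOrthogonality L) {n : ℕ}
    {A A' : Fin 3 → 𝕜[X]} (h : IsTypeI L n A) (h' : IsTypeI L n A') : A = A' := by
  have key : ∀ (a : Fin 3) (m : ℕ), n < 3 * m + (a : ℕ) → ((A - A') a).coeff m = 0 := by
    intro a m hm
    simp [h.1 a m hm, h'.1 a m hm]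
  rw [← sub_eq_zero, eq_stepVector key]
  have hv := Matrix.eq_zero_of_mulVec_eq_zero (hO (n + 1))
    (v := fun j : Fin (n + 1) => ((A - A') (Fin.ofNat 3 j)).coeff (j / 3)) (by
      ext l
      have hs : ∑ a, L a (X ^ (l : ℕ) * (A - A') a) = 0 := by
        have := h.2 l (Nat.lt_succ_iff.1 l.2)
        have h2 := h'.2 l (Nat.lt_succ_iff.1 l.2)
        have hsub : ∀ a (p q : 𝕜[X]), L a (p - q) = L a p - L a q := fun a => (hL a).map_sub
        simp only [Pi.sub_apply, mul_sub, hsub, Finset.sum_sub_distrib, this, h2, sub_self]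
      rw [eq_stepVector key, sum_map_stepVector hL, Finset.sum_range] at hs
      simp only [mul_comm (coeff _ _)] at hs
      exact hs)
  ext a m
  rw [coeff_stepVector]
  split_ifs with hm
  · exact congrFun hv ⟨3 * m + a, Nat.lt_succ_of_le hm⟩
  · rfl

theorem isTypeI_typeI (hL : ∀ a, IsLinearMap 𝕜 (L a)) (hO : HasOrthogonality L) (n : ℕ) :
    IsTypeI L n (typeI L n) := by
  have h := exists_isTypeI hL hO n
  rw [typeI, dif_pos h]
  exact h.choose_spec

theorem IsTypeI.sum_map (hL : ∀ a, IsLinearMap 𝕜 (L a)) {n : ℕ} {A : Fin 3 → 𝕜[X]}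
    (hA : IsTypeI L n A) {p : 𝕜[X]} (hp : p.natDegree ≤ n) :
    ∑ a, L a (p * A a) = p.coeff n := by
  have h : ∀ a, L a (p * A a) = ∑ l ∈ Finset.range (n + 1), p.coeff l * L a (X ^ l * A a) := by
    intro a
    conv_lhs => rw [as_sum_range_C_mul_X_pow' p (Nat.lt_succ_of_le hp), Finset.sum_mul]
    simp only [mul_assoc, map_sum_C_mul hL]
  simp only [h]
  rw [Finset.sum_comm]
  simp only [← Finset.mul_sum]
  rw [Finset.sum_congr rfl fun l hl => by rw [hA.2 l (Nat.lt_succ_iff.1 (Finset.mem_range.1 hl))]]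
  simp

/-- Biorthogonality of the type II and the type I polynomials. -/
theorem IsTypeII.sum_map_isTypeI (hL : ∀ a, IsLinearMap 𝕜 (L a)) {k n : ℕ} {B : 𝕜[X]}
    {A : Fin 3 → 𝕜[X]} (hB : IsTypeII L k B) (hA : IsTypeI L n A) :
    ∑ a, L a (B * A a) = if k = n then 1 else 0 := by
  -- For k ≤ n the type I conditions read off a coefficient of `B`; for k > n the type II conditions
  -- kill every column occurring in `A`.
  rcases le_or_gt k n with hkn | hnk
  · rw [hA.sum_map hL (hB.2.1.trans_le hkn)]
    split_ifs with h
    · rw [← h, ← hB.2.1]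
      exact hB.1
    · exact coeff_eq_zero_of_natDegree_lt (by have := hB.2.1; omega)
  · rw [if_neg hnk.ne', eq_stepVector hA.1, sum_map_stepVector hL]
    refine Finset.sum_eq_zero fun j hj => ?_
    rw [stepOrthogonal_iff.1 hB.2.2 j ((Finset.mem_range.1 hj).trans_le hnk), mul_zero]

end StepLineTheory
end JacobiPineiro
-- Christoffel-type formulas for an abstract row related by R.
namespace JacobiPineiro
section Perturbation

variable {𝕜 : Type*} [Field 𝕜]

theorem degree_C_mul_le (c : 𝕜) (p : 𝕜[X]) : (C c * p).degree ≤ p.degree := by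
  rw [← smul_eq_C_mul]
  exact degree_smul_le c p

/-- A linear functional is determined by its values at monic polynomials, one of each degree. -/
theorem linear_eq_of_monic_family {B : ℕ → 𝕜[X]} (hmon : ∀ k, (B k).Monic)
    (hdeg : ∀ k, (B k).natDegree = k) {n : ℕ} {f g : 𝕜[X] →ₗ[𝕜] 𝕜}
    (hB : ∀ k ≤ n, f (B k) = g (B k)) {p : 𝕜[X]} (hp : p.natDegree ≤ n) : f p = g p := by
  suffices H : ∀ m ≤ n + 1, ∀ p : 𝕜[X], p.degree < m → f p = g p from
    H (n + 1) le_rfl p ((degree_le_of_natDegree_le hp).trans_lt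
      ((Nat.cast_lt (α := WithBot ℕ)).2 n.lt_succ_self))
  intro m
  induction m with
  | zero =>
    intro _ p hp
    have : p = 0 := by simpa using hp
    simp [this]
  | succ m ih =>
    intro hm p hp
    -- Subtracting this multiple of the monic `B m` removes the top coefficient.
    have hlt : (p - p.coeff m • B m).degree < m := by
      rw [degree_lt_iff_coeff_zero]
      intro k hk
      rcases hk.eq_or_lt with rfl | hk
      · have := hmon m
        rw [Monic, leadingCoeff, hdeg] at this
        simp [this]
      · rw [coeff_sub, coeff_smul, (degree_lt_iff_coeff_zero _ _).1 hp k hk,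
          coeff_eq_zero_of_natDegree_lt (p := B m) (by rwa [hdeg])]
        simp
    have := ih (by omega) _ hlt
    rw [map_sub, map_sub, map_smul, map_smul, hB m (by omega)] at this
    exact sub_left_injective this

/-- The functionals `M` of the row `dν R` for a row `dν` with the functionals `L` and the
perturbation matrix `R`. -/
structure IsPerturbation (L M : Fin 3 → 𝕜[X] → 𝕜) : Prop where
  linear_left : ∀ a, IsLinearMap 𝕜 (L a)
  linear_right : ∀ a, IsLinearMap 𝕜 (M a)
  orth_left : HasOrthogonality L
  orth_right : HasOrthogonality M
  map_zero : ∀ p, M 0 p = L 2 p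
  map_one : ∀ p, M 1 p = L 0 (X * p)
  map_two : ∀ p, M 2 p = L 1 ((1 - X) * p)

namespace IsPerturbation

variable {L M : Fin 3 → 𝕜[X] → 𝕜} (h : IsPerturbation L M)
include h

/-- Columns 3(l+1), 3(l+1)+1 and 3l+2 of `L` correspond to columns 3l+1, 3l+2 and 3l of `M`, always
a shift by two. Only columns 0 and 1 of `L` have no counterpart; these are `h0` and `h1`. -/
theorem stepOrthogonal {n : ℕ} {p : 𝕜[X]} (h0 : L 0 p = 0) (h1 : L 1 p = 0)
    (hp : StepOrthogonal M (n - 2) p) : StepOrthogonal L n p := by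
  intro a
  fin_cases a
  · intro l hl
    cases l with
    | zero => simpa using h0
    | succ l =>
      have := hp 1 l (by simp at hl ⊢; omega)
      rw [h.map_one] at this
      rwa [mul_left_comm, ← pow_succ'] at this
  · intro l
    induction l with
    | zero => intro _; simpa using h1
    | succ l ih =>
      intro hl
      have := hp 2 l (by simp at hl ⊢; omega)
      rw [h.map_two] at this
      -- The factor 1 - x controls only differences of consecutive moments, so the condition
      -- propagates from l to l+1.
      have e : p * X ^ (l + 1) = p * X ^ l - (1 - X) * (p * X ^ l) := by ring
      simp only [Fin.mk_one] at ih ⊢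
      rw [e, (h.linear_left 1).map_sub, this, ih (by simp at hl ⊢; omega), sub_zero]
  · intro l hl
    have := hp 0 l (by simp at hl ⊢; omega)
    rwa [h.map_zero] at this

/-- The `2 × 2` determinant of the values of the first two functionals at consecutive type II
polynomials. -/
theorem det_ne_zero (n : ℕ) :
    L 0 (typeII M n) * L 1 (typeII M (n + 1)) - L 1 (typeII M n) * L 0 (typeII M (n + 1)) ≠ 0 := by
  set B := typeII M with hB
  have hII : ∀ k, IsTypeII M k (B k) := isTypeII_typeII h.linear_right h.orth_right
  intro hdet
  have hdeg : ∀ k, (B k).degree = k := fun k => by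
    rw [degree_eq_natDegree (hII k).1.ne_zero, (hII k).2.1]
  have horth : ∀ k, n ≤ k → StepOrthogonal M (n + 2 - 2) (B k) := fun k hk =>
    StepOrthogonal.mono (hII k).2.2 (by omega)
  -- The 2 × 2 system has trivial kernel: a solution gives a polynomial of degree below n+2
  -- orthogonal to n+2 columns of `L`.
  have hzero : ∀ c d : 𝕜, c * L 0 (B n) + d * L 0 (B (n + 1)) = 0 →
      c * L 1 (B n) + d * L 1 (B (n + 1)) = 0 → c = 0 ∧ d = 0 := by
    intro c d h0 h1
    have hval : ∀ a, L a (C c * B n + C d * B (n + 1)) = c * L a (B n) + d * L a (B (n + 1)) :=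
      fun a => by rw [(h.linear_left a).map_add, map_C_mul h.linear_left, map_C_mul h.linear_left]
    have hlt : (C c * B n + C d * B (n + 1)).degree < ((n + 2 : ℕ) : WithBot ℕ) := by
      refine (degree_add_le _ _).trans_lt (max_lt ?_ ?_)
      · refine (degree_C_mul_le _ _).trans_lt ?_
        rw [hdeg]; exact_mod_cast (by omega : n < n + 2)
      · refine (degree_C_mul_le _ _).trans_lt ?_
        rw [hdeg]; exact_mod_cast (by omega : n + 1 < n + 2)
    have hq := eq_zero_of_stepOrthogonal h.linear_left h.orth_left hlt
      (h.stepOrthogonal ((hval 0).trans h0) ((hval 1).trans h1)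
        (((horth n le_rfl).C_mul h.linear_right c).add h.linear_right
          ((horth (n + 1) (Nat.le_succ n)).C_mul h.linear_right d)))
    have lead : ∀ k, (B k).coeff k = 1 := fun k => by
      have := (hII k).1
      rwa [Monic, leadingCoeff, (hII k).2.1] at this
    have hd : d = 0 := by
      have := congrArg (fun p => p.coeff (n + 1)) hq
      simpa [lead, coeff_eq_zero_of_degree_lt ((hdeg n).trans_lt
        (by exact_mod_cast Nat.lt_succ_self n : (n : WithBot ℕ) < ((n + 1 : ℕ) : WithBot ℕ)))]
        using this
    subst hd
    have := congrArg (fun p => p.coeff n) hq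
    exact ⟨by simpa [lead] using this, rfl⟩
  -- If the determinant vanishes, both cofactor vectors lie in the kernel. So all four entries are
  -- zero, and then (1, 0) lies in the kernel too.
  have z0 := hzero (L 0 (B (n + 1))) (-L 0 (B n)) (by ring) (by linear_combination -hdet)
  have z1 := hzero (L 1 (B (n + 1))) (-L 1 (B n)) (by linear_combination hdet) (by ring)
  exact one_ne_zero (hzero 1 0 (by simp [neg_eq_zero.1 z0.2]) (by simp [neg_eq_zero.1 z1.2])).1

/-- The right side is the 3 × 3 determinant expanded along its polynomial column. Applying `L 0` or
`L 1` produces two equal columns, so it is orthogonal to n+2 columns of `L`. Both sides have the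
same coefficient at degree n+2, so their difference vanishes. -/
theorem typeII_mul_det (n : ℕ) :
    C (L 0 (typeII M n) * L 1 (typeII M (n + 1)) - L 1 (typeII M n) * L 0 (typeII M (n + 1))) *
        typeII L (n + 2) =
      C (L 0 (typeII M (n + 1)) * L 1 (typeII M (n + 2)) -
        L 1 (typeII M (n + 1)) * L 0 (typeII M (n + 2))) * typeII M n
      - C (L 0 (typeII M n) * L 1 (typeII M (n + 2)) -
        L 1 (typeII M n) * L 0 (typeII M (n + 2))) * typeII M (n + 1)
      + C (L 0 (typeII M n) * L 1 (typeII M (n + 1)) -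
        L 1 (typeII M n) * L 0 (typeII M (n + 1))) * typeII M (n + 2) := by
  have hdet := h.det_ne_zero n
  set B := typeII M with hB
  have hII : ∀ k, IsTypeII M k (B k) := isTypeII_typeII h.linear_right h.orth_right
  have hI := isTypeII_typeII h.linear_left h.orth_left (n + 2)
  set t := L 0 (B n) * L 1 (B (n + 1)) - L 1 (B n) * L 0 (B (n + 1)) with ht
  set u := L 0 (B (n + 1)) * L 1 (B (n + 2)) - L 1 (B (n + 1)) * L 0 (B (n + 2)) with hu
  set v := L 0 (B n) * L 1 (B (n + 2)) - L 1 (B n) * L 0 (B (n + 2)) with hv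
  have horth : ∀ k, n ≤ k → StepOrthogonal M (n + 2 - 2) (B k) := fun k hk =>
    StepOrthogonal.mono (hII k).2.2 (by omega)
  have hval : ∀ a, L a (C u * B n + C (-v) * B (n + 1) + C t * B (n + 2)) =
      u * L a (B n) + -v * L a (B (n + 1)) + t * L a (B (n + 2)) := fun a => by
    simp only [(h.linear_left a).map_add, map_C_mul h.linear_left]
  have hR := h.stepOrthogonal (n := n + 2)
    ((hval 0).trans (by rw [hu, hv, ht]; ring)) ((hval 1).trans (by rw [hu, hv, ht]; ring))
    ((((horth n le_rfl).C_mul h.linear_right u).add h.linear_right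
      ((horth (n + 1) (by omega)).C_mul h.linear_right (-v))).add h.linear_right
      ((horth (n + 2) (by omega)).C_mul h.linear_right t))
  have hdeg : ∀ k, (B k).degree = k := fun k => by
    rw [degree_eq_natDegree (hII k).1.ne_zero, (hII k).2.1]
  have hdI : (typeII L (n + 2)).degree = (n + 2 : ℕ) := by
    rw [degree_eq_natDegree hI.1.ne_zero, hI.2.1]
  have hsub : (typeII L (n + 2) - B (n + 2)).degree < ((n + 2 : ℕ) : WithBot ℕ) := by
    rw [← hdI]
    exact degree_sub_lt_left (hdI.trans (hdeg _).symm) hI.1.ne_zero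
      (hI.1.trans (hII (n + 2)).1.symm)
  have hlt : ∀ (c : 𝕜) (k : ℕ), k < n + 2 → (C c * B k).degree < ((n + 2 : ℕ) : WithBot ℕ) := by
    intro c k hk
    refine (degree_C_mul_le _ _).trans_lt ?_
    rw [hdeg]; exact_mod_cast hk
  rw [← sub_eq_zero]
  refine eq_zero_of_stepOrthogonal h.linear_left h.orth_left (n := n + 2) ?_ ?_
  · have e : C t * typeII L (n + 2) - (C u * B n - C v * B (n + 1) + C t * B (n + 2)) =
        C t * (typeII L (n + 2) - B (n + 2)) + (C (-u) * B n + C v * B (n + 1)) := by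
      simp only [C_neg]; ring
    rw [e]
    exact (degree_add_le _ _).trans_lt (max_lt ((degree_C_mul_le _ _).trans_lt hsub)
      ((degree_add_le _ _).trans_lt (max_lt (hlt _ _ (by omega)) (hlt _ _ (by omega)))))
  · have e : C t * typeII L (n + 2) - (C u * B n - C v * B (n + 1) + C t * B (n + 2)) =
        C t * typeII L (n + 2) + C (-1) * (C u * B n + C (-v) * B (n + 1) + C t * B (n + 2)) := by
      simp only [C_neg, C_1]; ring
    rw [e]
    exact (StepOrthogonal.C_mul h.linear_left hI.2.2 t).add h.linear_left
      (hR.C_mul h.linear_left (-1))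

/-- The type I vector of the perturbed row in terms of that of the original one. -/
theorem typeI_eq (n : ℕ) {c : ℕ → 𝕜} {u v : 𝕜}
    (hc : ∀ i, (L 0 (typeII M n) * L 1 (typeII M (n + 1)) -
      L 1 (typeII M n) * L 0 (typeII M (n + 1))) * c i =
        L 0 (typeII M i) * L 1 (typeII M n) - L 1 (typeII M i) * L 0 (typeII M n))
    (hu : (L 0 (typeII M n) * L 1 (typeII M (n + 1)) -
      L 1 (typeII M n) * L 0 (typeII M (n + 1))) * u = -L 1 (typeII M n))
    (hv : (L 0 (typeII M n) * L 1 (typeII M (n + 1)) -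
      L 1 (typeII M n) * L 0 (typeII M (n + 1))) * v = L 0 (typeII M n)) :
    typeI L (n + 1) =
      ![∑ i ∈ Finset.range n, C (c i) * (X * typeI M i 1) + C u,
        ∑ i ∈ Finset.range n, C (c i) * ((1 - X) * typeI M i 2) + C v,
        ∑ i ∈ Finset.range n, C (c i) * typeI M i 0] := by
  have hdet := h.det_ne_zero n
  set B := typeII M with hB
  have hII : ∀ k, IsTypeII M k (B k) := isTypeII_typeII h.linear_right h.orth_right
  have hI : ∀ k, IsTypeI M k (typeI M k) := isTypeI_typeI h.linear_right h.orth_right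
  refine (isTypeI_typeI h.linear_left h.orth_left (n + 1)).eq h.linear_left h.orth_left ⟨?_, ?_⟩
  -- Each entry puts column j of `M` into columns at most j+2 of `L`, and i < n gives i+2 ≤ n+1. The
  -- constants `u`, `v` occupy columns 0 and 1.
  · intro a m
    fin_cases a
    · intro hm
      cases m with
      | zero => simp at hm
      | succ m =>
        simp only [Fin.zero_eta, Matrix.cons_val_zero, coeff_add, finsetSum_coeff, coeff_C_mul,
          coeff_X_mul, coeff_C_succ, add_zero]
        refine Finset.sum_eq_zero fun i hi => ?_
        have := Finset.mem_range.1 hi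
        rw [(hI i).1 1 m (by simp at hm ⊢; omega), mul_zero]
    · intro hm
      cases m with
      | zero => simp at hm
      | succ m =>
        simp only [Fin.mk_one, Matrix.cons_val_one, Matrix.cons_val_zero, coeff_add,
          finsetSum_coeff, coeff_C_mul, sub_mul, one_mul, coeff_sub, coeff_X_mul, coeff_C_succ,
          add_zero]
        refine Finset.sum_eq_zero fun i hi => ?_
        have := Finset.mem_range.1 hi
        rw [(hI i).1 2 m (by simp at hm ⊢; omega), (hI i).1 2 (m + 1) (by simp at hm ⊢; omega),
          sub_zero, mul_zero]
    · intro hm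
      simp only [Fin.reduceFinMk, Matrix.cons_val, finsetSum_coeff, coeff_C_mul]
      refine Finset.sum_eq_zero fun i hi => ?_
      have := Finset.mem_range.1 hi
      rw [(hI i).1 0 m (by simp at hm ⊢; omega), mul_zero]
  · have hval : ∀ p, ∑ a, L a (p * (![∑ i ∈ Finset.range n, C (c i) * (X * typeI M i 1) + C u,
        ∑ i ∈ Finset.range n, C (c i) * ((1 - X) * typeI M i 2) + C v,
        ∑ i ∈ Finset.range n, C (c i) * typeI M i 0] : Fin 3 → 𝕜[X]) a) =
        ∑ i ∈ Finset.range n, c i * ∑ a, M a (p * typeI M i a) + u * L 0 p + v * L 1 p := by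
      intro p
      simp only [Fin.sum_univ_three, Matrix.cons_val_zero, Matrix.cons_val_one, Matrix.cons_val,
        mul_add, Finset.mul_sum, mul_left_comm p (C _), (h.linear_left _).map_add,
        map_sum_C_mul h.linear_left, h.map_zero, h.map_one, h.map_two, Finset.sum_add_distrib,
        mul_left_comm p X, mul_left_comm p (1 - X), mul_comm p (C _), map_C_mul h.linear_left]
      ring
    let f : 𝕜[X] →ₗ[𝕜] 𝕜 := ∑ i ∈ Finset.range n, c i • ∑ a, (IsLinearMap.mk' _
      (h.linear_right a)).comp (LinearMap.mulRight 𝕜 (typeI M i a)) +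
      u • IsLinearMap.mk' _ (h.linear_left 0) + v • IsLinearMap.mk' _ (h.linear_left 1)
    have hf : ∀ p, f p =
        ∑ i ∈ Finset.range n, c i * ∑ a, M a (p * typeI M i a) + u * L 0 p + v * L 1 p := by
      intro p
      simp [f, LinearMap.sum_apply]
    -- Testing on the `B k` instead of monomials makes the sum collapse by biorthogonality to `c k`
    -- for k < n and to 0 otherwise.
    have hfB : ∀ k ≤ n + 1, f (B k) = lcoeff 𝕜 (n + 1) (B k) := by
      intro k hk
      refine mul_left_cancel₀ hdet ?_
      have hsum : ∑ i ∈ Finset.range n, c i * ∑ a, M a (B k * typeI M i a) =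
          if k < n then c k else 0 := by
        simp only [(hII k).sum_map_isTypeI h.linear_right (hI _)]
        simp
      rw [hf, hsum, lcoeff_apply]
      -- The values of `u` and `v` are Cramer's solution of the equations at k = n and k = n+1;
      -- those at k < n then determine `c k`.
      rcases lt_trichotomy k n with hkn | rfl | hkn
      · rw [if_pos hkn, coeff_eq_zero_of_natDegree_lt (by rw [(hII k).2.1]; omega)]
        linear_combination hc k + L 0 (B k) * hu + L 1 (B k) * hv
      · rw [if_neg (lt_irrefl _), coeff_eq_zero_of_natDegree_lt (by rw [(hII k).2.1]; omega)]
        linear_combination L 0 (B k) * hu + L 1 (B k) * hv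
      · obtain rfl : k = n + 1 := by omega
        have := (hII (n + 1)).1
        rw [Monic, leadingCoeff, (hII (n + 1)).2.1] at this
        rw [if_neg (by omega), this]
        linear_combination L 0 (B (n + 1)) * hu + L 1 (B (n + 1)) * hv
    intro l hl
    rw [hval, ← hf, linear_eq_of_monic_family (fun k => (hII k).1) (fun k => (hII k).2.1) hfB
      (by simpa using hl), lcoeff_apply, coeff_X_pow]
    simp only [eq_comm]

end IsPerturbation
end Perturbation
end JacobiPineiro
-- Jacobi moments and orthogonality for the Jacobi–Piñeiro row.
namespace JacobiPineiro
section JacobiMoments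

open MeasureTheory

theorem integrableOn_jacobiWeight {s t : ℝ} (hs : -1 < s) (ht : -1 < t) :
    IntegrableOn (fun x : ℝ => x ^ s * (1 - x) ^ t) (Set.Ioc 0 1) := by
  have h := Complex.betaIntegral_convergent (u := ((s + 1 : ℝ) : ℂ)) (v := ((t + 1 : ℝ) : ℂ))
    (by simpa using by linarith) (by simpa using by linarith)
  rw [intervalIntegrable_iff_integrableOn_Ioc_of_le zero_le_one] at h
  refine (integrableOn_congr_fun (fun x hx => ?_) measurableSet_Ioc).1 (Integrable.re h)
  have h1 : (0 : ℝ) ≤ 1 - x := by linarith [hx.2]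
  have e : (x : ℂ) ^ (((s + 1 : ℝ) : ℂ) - 1) * (1 - (x : ℂ)) ^ (((t + 1 : ℝ) : ℂ) - 1) =
      ((x ^ s * (1 - x) ^ t : ℝ) : ℂ) := by
    push_cast
    rw [Complex.ofReal_cpow hx.1.le, Complex.ofReal_cpow h1]
    push_cast
    ring_nf
  simp only [e]
  exact Complex.ofReal_re _

theorem integral_jacobiWeight {s t : ℝ} (hs : -1 < s) (ht : -1 < t) :
    ∫ x in (0 : ℝ)..1, x ^ s * (1 - x) ^ t = ProbabilityTheory.beta (s + 1) (t + 1) := by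
  rw [ProbabilityTheory.beta_eq_betaIntegralReal _ _ (by linarith) (by linarith),
    Complex.betaIntegral, ← Complex.ofReal_re (∫ x in (0 : ℝ)..1, x ^ s * (1 - x) ^ t),
    ← intervalIntegral.integral_ofReal]
  congr 1
  rw [intervalIntegral.integral_of_le zero_le_one, intervalIntegral.integral_of_le zero_le_one]
  refine setIntegral_congr_fun measurableSet_Ioc fun x hx => ?_
  have h1 : (0 : ℝ) ≤ 1 - x := by linarith [hx.2]
  simp only [Complex.ofReal_mul, Complex.ofReal_cpow hx.1.le, Complex.ofReal_cpow h1]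
  push_cast
  ring_nf

theorem beta_add_one_left {u v : ℝ} (hu : 0 < u) (hv : 0 < v) :
    (u + v) * ProbabilityTheory.beta (u + 1) v = u * ProbabilityTheory.beta u v := by
  have h1 : u + v ≠ 0 := by positivity
  have h2 := (Real.Gamma_pos_of_pos (add_pos hu hv)).ne'
  rw [ProbabilityTheory.beta, ProbabilityTheory.beta, Real.Gamma_add_one hu.ne',
    show u + 1 + v = u + v + 1 by ring, Real.Gamma_add_one h1]
  field_simp

/-- Makes B(u+i, v)/B(u, v) a rational function of u, in cross-multiplied form. -/
theorem beta_add_nat_left {u v : ℝ} (hu : 0 < u) (hv : 0 < v) (i : ℕ) :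
    (∏ t ∈ Finset.range i, (u + v + t)) * ProbabilityTheory.beta (u + i) v =
      (∏ t ∈ Finset.range i, (u + t)) * ProbabilityTheory.beta u v := by
  induction i with
  | zero => simp
  | succ i ih =>
    have := beta_add_one_left (u := u + i) (by positivity) hv
    rw [Finset.prod_range_succ, Finset.prod_range_succ, Nat.cast_add, Nat.cast_one, ← add_assoc]
    linear_combination (∏ t ∈ Finset.range i, (u + v + t)) * this + (u + i) * ih

variable {𝕜 : Type*} [RCLike 𝕜]

theorem integrableOn_jacobi_eval {s t : ℝ} (hs : -1 < s) (ht : -1 < t) (p : 𝕜[X]) :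
    IntegrableOn (fun x : ℝ => ((x ^ s * (1 - x) ^ t : ℝ) : 𝕜) * p.eval (x : 𝕜))
      (Set.Ioc 0 1) := by
  have h : IntegrableOn (fun x : ℝ => ((x ^ s * (1 - x) ^ t : ℝ) : 𝕜)) (Set.Ioc 0 1) :=
    (integrableOn_jacobiWeight hs ht).ofReal
  have hc : Continuous fun x : ℝ => p.eval (x : 𝕜) := p.continuous.comp RCLike.continuous_ofReal
  rw [← integrableOn_Icc_iff_integrableOn_Ioc] at h ⊢
  exact h.mul_continuousOn hc.continuousOn isCompact_Icc

theorem isLinearMap_jacobiIntegral {s t : ℝ} (hs : -1 < s) (ht : -1 < t) :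
    IsLinearMap 𝕜 (jacobiIntegral s t : 𝕜[X] → 𝕜) where
  map_add p q := by
    simp only [jacobiIntegral, intervalIntegral.integral_of_le zero_le_one, eval_add, mul_add]
    exact integral_add (integrableOn_jacobi_eval hs ht p) (integrableOn_jacobi_eval hs ht q)
  map_smul c p := by
    simp only [jacobiIntegral, intervalIntegral.integral_of_le zero_le_one, eval_smul,
      smul_eq_mul, mul_left_comm _ c]
    exact integral_const_mul _ _

theorem isLinearMap_jpMeasure {α : Fin 3 → ℝ} {β : ℝ} (hα : ∀ a, -1 < α a) (hβ : 0 < β)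
    (a : Fin 3) : IsLinearMap 𝕜 (jpMeasure α β a : 𝕜[X] → 𝕜) :=
  isLinearMap_jacobiIntegral (hα a) (by linarith)

theorem isLinearMap_perturbedMeasure {α : Fin 3 → ℝ} {β : ℝ} (ξ₀ ξ₁ : 𝕜) (hα : ∀ a, -1 < α a)
    (hα₂ : 0 < α 1) (hβ : 0 < β) (a : Fin 3) :
    IsLinearMap 𝕜 (perturbedMeasure α β ξ₀ ξ₁ a) := by
  have h0 := isLinearMap_jacobiIntegral (𝕜 := 𝕜) (s := α 1 - 1) (t := β) (by linarith)
    (by linarith)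
  have h1 := isLinearMap_jacobiIntegral (𝕜 := 𝕜) (s := α 2) (t := β - 1) (hα 2) (by linarith)
  fin_cases a
  · exact ⟨fun p q => by simp [perturbedMeasure, h0.map_add]; ring,
      fun c p => by simp [perturbedMeasure, h0.map_smul]; ring⟩
  · exact ⟨fun p q => by simp [perturbedMeasure, h1.map_add]; ring,
      fun c p => by simp [perturbedMeasure, h1.map_smul]; ring⟩
  · exact isLinearMap_jacobiIntegral (hα 0) (by linarith)

theorem jacobiIntegral_X_pow {s t : ℝ} (hs : -1 < s) (ht : -1 < t) (i : ℕ) :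
    jacobiIntegral s t (X ^ i : 𝕜[X]) = (ProbabilityTheory.beta (s + 1 + i) (t + 1) : 𝕜) := by
  have hi : (0 : ℝ) ≤ i := i.cast_nonneg
  rw [show s + 1 + i = s + i + 1 by ring, ← integral_jacobiWeight (by linarith) ht,
    jacobiIntegral, intervalIntegral.integral_of_le zero_le_one,
    intervalIntegral.integral_of_le zero_le_one, ← integral_ofReal]
  refine setIntegral_congr_fun measurableSet_Ioc fun x hx => ?_
  simp only [Real.rpow_add hx.1, Real.rpow_natCast, eval_pow, eval_X]
  push_cast
  ring

/-- A nontrivial linear combination of the moments `B(u + i, v)`, `i < k`, as a function of `u`,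
is a nonvanishing factor times a nonzero polynomial of degree less than `k`. -/
theorem coeff_eq_zero_of_sum_beta {v : ℝ} (hv : 0 < v) {k : ℕ} {c : ℕ → 𝕜} {u : Fin k → ℝ}
    (hu : ∀ j, 0 < u j) (hinj : Function.Injective u)
    (h : ∀ j, ∑ i ∈ Finset.range k, c i * (ProbabilityTheory.beta (u j + i) v : 𝕜) = 0) :
    ∀ i < k, c i = 0 := by
  -- `q i` is B(u+i, v)/B(u, v) multiplied by the common denominator ∏ (u+v+t), t < k-1.
  set q : ℕ → 𝕜[X] := fun i => (∏ t ∈ Finset.range i, (X + C (t : 𝕜))) *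
    ∏ t ∈ Finset.Ico i (k - 1), (X + C ((v + t : ℝ) : 𝕜)) with hq
  have hqd : ∀ i < k, (q i).natDegree ≤ k - 1 := by
    intro i hi
    refine natDegree_mul_le.trans ?_
    refine (add_le_add (natDegree_prod_le _ _) (natDegree_prod_le _ _)).trans ?_
    simp only [natDegree_X_add_C, Finset.sum_const, smul_eq_mul, Finset.card_range, Nat.card_Ico]
    omega
  -- The degree is below k, and the k distinct points `u j` are zeros.
  have hQ : ∑ i ∈ Finset.range k, C (c i) * q i = 0 := by
    refine eq_zero_of_degree_lt_of_eval_index_eq_zero (s := Finset.univ)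
      (v := fun j : Fin k => (u j : 𝕜))
      (fun a _ b _ hab => hinj (RCLike.ofReal_injective hab)) ?_ ?_
    · rw [Finset.card_univ, Fintype.card_fin]
      refine (degree_sum_le _ _).trans_lt ((Finset.sup_lt_iff (WithBot.bot_lt_coe k)).2 ?_)
      intro i hi
      have hi := Finset.mem_range.1 hi
      refine (degree_C_mul_le _ _).trans_lt ((degree_le_of_natDegree_le (hqd i hi)).trans_lt ?_)
      exact (Nat.cast_lt (α := WithBot ℕ)).2 (by omega)
    · intro j _
      have hb : (ProbabilityTheory.beta (u j) v : 𝕜) ≠ 0 :=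
        RCLike.ofReal_ne_zero.2 (ProbabilityTheory.beta_pos (hu j) hv).ne'
      refine mul_right_cancel₀ hb ?_
      rw [zero_mul, eval_finsetSum, Finset.sum_mul]
      have key : ∀ i ∈ Finset.range k, (C (c i) * q i).eval (u j : 𝕜) *
          (ProbabilityTheory.beta (u j) v : 𝕜) =
          (∏ t ∈ Finset.range (k - 1), ((u j + v + t : ℝ) : 𝕜)) *
            (c i * (ProbabilityTheory.beta (u j + i) v : 𝕜)) := by
        intro i hi
        have hi := Finset.mem_range.1 hi
        have hr := congrArg (RCLike.ofReal (K := 𝕜)) (beta_add_nat_left (hu j) hv i)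
        push_cast at hr
        rw [← Finset.prod_range_mul_prod_Ico _ (show i ≤ k - 1 by omega)]
        simp only [hq, eval_mul, eval_C, eval_prod, eval_add, eval_X]
        push_cast
        simp only [← add_assoc]
        linear_combination (-c i * ∏ t ∈ Finset.Ico i (k - 1), ((u j : 𝕜) + v + t)) * hr
      rw [Finset.sum_congr rfl key, ← Finset.mul_sum, h j, mul_zero]
  intro i
  induction i using Nat.strong_induction_on with
  | _ i ih =>
    intro hi
    -- At -i every `q t` with t > i vanishes through its factor X+i, and terms with t < i are gone
    -- by induction. The value of `q i` is nonzero because v > 0.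
    have he := congrArg (eval (-(i : 𝕜))) hQ
    rw [eval_zero, eval_finsetSum, Finset.sum_eq_single_of_mem i (Finset.mem_range.2 hi)] at he
    · rw [eval_mul, eval_C] at he
      refine (mul_eq_zero.1 he).resolve_right ?_
      simp only [hq, eval_mul, eval_prod, eval_add, eval_X, eval_C]
      refine mul_ne_zero (Finset.prod_ne_zero_iff.2 fun t ht => ?_)
        (Finset.prod_ne_zero_iff.2 fun t ht => ?_)
      · have := Finset.mem_range.1 ht
        rw [neg_add_eq_sub, sub_ne_zero]
        exact_mod_cast this.ne
      · have ht := (Finset.mem_Ico.1 ht).1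
        have hti : (i : ℝ) ≤ t := by exact_mod_cast ht
        have : (-(i : ℝ) + (v + t)) ≠ 0 := by linarith
        exact_mod_cast (RCLike.ofReal_ne_zero (K := 𝕜)).2 this
    · intro t ht hti
      rcases lt_or_gt_of_ne hti with hlt | hgt
      · simp [ih t hlt (Finset.mem_range.1 ht)]
      · have : eval (-(i : 𝕜)) (∏ t ∈ Finset.range t, (X + C (t : 𝕜))) = 0 := by
          rw [eval_prod]
          exact Finset.prod_eq_zero (Finset.mem_range.2 hgt) (by simp)
        simp only [hq, eval_mul, this, zero_mul, mul_zero]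

/-- The moment in row i and column j is B(uⱼ+i, β+1) with uⱼ = αₐ+m+1. The uⱼ are distinct because
no αₐ-α_b with a ≠ b is an integer, so a left kernel vector must vanish. -/
theorem hasOrthogonality_jpMeasure {α : Fin 3 → ℝ} {β : ℝ} (hα : ∀ a, -1 < α a)
    (hαα : ∀ a b, a ≠ b → ∀ k : ℤ, α a - α b ≠ k) (hβ : 0 < β) :
    HasOrthogonality (jpMeasure α β : Fin 3 → 𝕜[X] → 𝕜) := by
  intro k hdet
  obtain ⟨c, hc, hcA⟩ := Matrix.exists_vecMul_eq_zero_iff.2 hdet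
  refine hc ?_
  have key := coeff_eq_zero_of_sum_beta (v := β + 1) (by linarith)
    (c := fun i => if h : i < k then c ⟨i, h⟩ else 0)
    (u := fun j : Fin k => α (Fin.ofNat 3 j) + ((j : ℕ) / 3 : ℕ) + 1) (fun j => ?_) ?_ (fun j => ?_)
  · ext i
    simpa using key i i.2
  · have : (0 : ℝ) ≤ ((j : ℕ) / 3 : ℕ) := Nat.cast_nonneg _
    linarith [hα (Fin.ofNat 3 j)]
  · intro j l hjl
    simp only at hjl
    have hmod : Fin.ofNat 3 (j : ℕ) = Fin.ofNat 3 (l : ℕ) := by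
      by_contra hne
      refine hαα _ _ hne ((((l : ℕ) / 3 : ℕ) : ℤ) - (((j : ℕ) / 3 : ℕ) : ℤ)) ?_
      rw [Int.cast_sub, Int.cast_natCast, Int.cast_natCast]
      linarith
    rw [hmod] at hjl
    have hdiv : (j : ℕ) / 3 = (l : ℕ) / 3 := by
      have : (((j : ℕ) / 3 : ℕ) : ℝ) = ((l : ℕ) / 3 : ℕ) := by linarith
      exact_mod_cast this
    ext
    rw [← three_mul_div_add_ofNat j, hmod, hdiv, three_mul_div_add_ofNat]
  · rw [Finset.sum_range]
    refine Eq.trans (Finset.sum_congr rfl fun i _ => ?_) (congrFun hcA j)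
    simp only [dif_pos i.2, Matrix.of_apply, momentMatrix, jpMeasure, ← pow_add]
    rw [jacobiIntegral_X_pow (hα _) (by linarith)]
    congr 3
    push_cast
    ring

end JacobiMoments
end JacobiPineiro
-- Identification of the entries of τ with values of the perturbed functionals.
namespace JacobiPineiro
section Transformation

open MeasureTheory

variable {𝕜 : Type*} [RCLike 𝕜]

theorem isPerturbation_jpMeasure {α : Fin 3 → ℝ} {β : ℝ} {ξ₀ ξ₁ : 𝕜} (hα : ∀ a, -1 < α a)
    (hαα : ∀ a b, a ≠ b → ∀ k : ℤ, α a - α b ≠ k) (hα₂ : 0 < α 1) (hβ : 0 < β)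
    (hpert : HasOrthogonality (perturbedMeasure α β ξ₀ ξ₁)) :
    IsPerturbation (perturbedMeasure α β ξ₀ ξ₁) (jpMeasure α β) := by
  have hL := isLinearMap_perturbedMeasure ξ₀ ξ₁ hα hα₂ hβ
  have h := perturbedMeasure_mul_perturbationMatrix α β ξ₀ ξ₁
  have h0 : ∀ a, perturbedMeasure α β ξ₀ ξ₁ a 0 = 0 := fun a => (hL a).map_zero
  refine ⟨hL, isLinearMap_jpMeasure hα hβ, hpert, hasOrthogonality_jpMeasure hα hαα hβ,
    fun p => ?_, fun p => ?_, fun p => ?_⟩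
  · simpa [Fin.sum_univ_three, perturbationMatrix, h0] using (h 0 p).symm
  · simpa [Fin.sum_univ_three, perturbationMatrix, h0] using (h 1 p).symm
  · simpa [Fin.sum_univ_three, perturbationMatrix, h0] using (h 2 p).symm

/-- The Cauchy kernel at 0 is -1/x, which lowers the exponent of x by one and produces the sign. -/
theorem d₀_eq (α : Fin 3 → ℝ) (β : ℝ) (ξ₀ ξ₁ : 𝕜) (n : ℕ) :
    d₀ α β ξ₀ n = -perturbedMeasure α β ξ₀ ξ₁ 0 (typeII (jpMeasure α β) n) := by
  have hD : D α β n 1 (0 : 𝕜) = -jacobiIntegral (α 1 - 1) β (P 𝕜 α β n) := by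
    rw [D, jacobiIntegral, ← intervalIntegral.integral_neg,
      intervalIntegral.integral_of_le zero_le_one, intervalIntegral.integral_of_le zero_le_one]
    refine setIntegral_congr_fun measurableSet_Ioc fun x hx => ?_
    have hx0 : (x : 𝕜) ≠ 0 := RCLike.ofReal_ne_zero.2 hx.1.ne'
    have : x ^ α 1 = x ^ (α 1 - 1) * x := by
      rw [Real.rpow_sub_one hx.1.ne', div_mul_cancel₀ _ hx.1.ne']
    simp only [this]
    push_cast
    field_simp
    ring
  rw [d₀, hD]
  simp only [perturbedMeasure, Matrix.cons_val_zero, P]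
  ring

/-- The kernel at 1 is 1/(1-x), so here no sign appears. The endpoint x = 1 is discarded as a null
set. -/
theorem d₁_eq (α : Fin 3 → ℝ) (β : ℝ) (ξ₀ ξ₁ : 𝕜) (n : ℕ) :
    d₁ α β ξ₁ n = perturbedMeasure α β ξ₀ ξ₁ 1 (typeII (jpMeasure α β) n) := by
  have hD : D α β n 2 (1 : 𝕜) = jacobiIntegral (α 2) (β - 1) (P 𝕜 α β n) := by
    rw [D, jacobiIntegral, intervalIntegral.integral_of_le zero_le_one,
      intervalIntegral.integral_of_le zero_le_one, integral_Ioc_eq_integral_Ioo,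
      integral_Ioc_eq_integral_Ioo]
    refine setIntegral_congr_fun measurableSet_Ioo fun x hx => ?_
    have h1 : 1 - x ≠ 0 := (sub_pos.2 hx.2).ne'
    have hx1 : (1 - x : 𝕜) ≠ 0 := by exact_mod_cast (RCLike.ofReal_ne_zero (K := 𝕜)).2 h1
    have : (1 - x) ^ β = (1 - x) ^ (β - 1) * (1 - x) := by
      rw [Real.rpow_sub_one h1, div_mul_cancel₀ _ h1]
    simp only [this]
    push_cast
    field_simp
  rw [d₁, hD]
  simp only [perturbedMeasure, Matrix.cons_val_one, Matrix.cons_val_zero, P]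
  ring

end Transformation
end JacobiPineiro

/-! ### The main theorem. -/

open JacobiPineiro in
theorem mainTheorem8 {𝕜 : Type*} [RCLike 𝕜] (α : Fin 3 → ℝ) (β : ℝ) (ξ₀ ξ₁ : 𝕜)
    (hα : ∀ a, -1 < α a) (hαα : ∀ a b, a ≠ b → ∀ k : ℤ, α a - α b ≠ k)
    (hα₂ : 0 < α 1) (hβ : 0 < β)
    (hpert : HasOrthogonality (perturbedMeasure α β ξ₀ ξ₁)) :
    (∀ n : ℕ, 1 ≤ n → τ α β ξ₀ ξ₁ n ≠ 0) ∧
    (∀ n : ℕ, 1 < n → ∀ x : 𝕜,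
      (fun a => (typeI (perturbedMeasure α β ξ₀ ξ₁) n a).eval x) =
        (1 / τ α β ξ₀ ξ₁ n) • ∑ i ∈ Finset.range (n - 1),
            Matrix.det !![d₀ α β ξ₀ i, d₁ α β ξ₁ i;
                          d₀ α β ξ₀ (n - 1), d₁ α β ξ₁ (n - 1)] •
              ![x * (PI 𝕜 α β i 1).eval x,
                (1 - x) * (PI 𝕜 α β i 2).eval x,
                (PI 𝕜 α β i 0).eval x]
          + (1 / τ α β ξ₀ ξ₁ n) • ![d₁ α β ξ₁ (n - 1), d₀ α β ξ₀ (n - 1), 0]) ∧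
    (∀ n : ℕ, 1 < n → ∀ x : 𝕜,
      (typeII (perturbedMeasure α β ξ₀ ξ₁) n).eval x =
        1 / τ α β ξ₀ ξ₁ (n - 1) *
          Matrix.det
            !![d₀ α β ξ₀ (n - 2), d₁ α β ξ₁ (n - 2), (P 𝕜 α β (n - 2)).eval x;
               d₀ α β ξ₀ (n - 1), d₁ α β ξ₁ (n - 1), (P 𝕜 α β (n - 1)).eval x;
               d₀ α β ξ₀ n, d₁ α β ξ₁ n, (P 𝕜 α β n).eval x]) := by
  have h := isPerturbation_jpMeasure hα hαα hα₂ hβ hpert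
  have e₀ := d₀_eq α β ξ₀ ξ₁
  have e₁ := d₁_eq α β ξ₀ ξ₁
  -- The minus sign comes from the entry d⁰ = -L₁P.
  have hτ : ∀ n, τ α β ξ₀ ξ₁ (n + 1) = -(
      perturbedMeasure α β ξ₀ ξ₁ 0 (typeII (jpMeasure α β) n) *
        perturbedMeasure α β ξ₀ ξ₁ 1 (typeII (jpMeasure α β) (n + 1)) -
      perturbedMeasure α β ξ₀ ξ₁ 1 (typeII (jpMeasure α β) n) *
        perturbedMeasure α β ξ₀ ξ₁ 0 (typeII (jpMeasure α β) (n + 1))) := by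
    intro n
    rw [τ, Matrix.det_fin_two_of, Nat.add_sub_cancel, e₀, e₀, e₁, e₁]
    ring
  have hτ0 : ∀ n, τ α β ξ₀ ξ₁ (n + 1) ≠ 0 := fun n => by
    rw [hτ]
    exact neg_ne_zero.2 (h.det_ne_zero n)
  refine ⟨fun n hn => ?_, fun n hn x => ?_, fun n hn x => ?_⟩
  · obtain ⟨n, rfl⟩ := Nat.exists_eq_add_of_le' hn
    exact hτ0 n
  · obtain ⟨n, rfl⟩ := Nat.exists_eq_add_of_le' hn.le
    have hT := hτ0 n
    have hI := h.typeI_eq n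
      (c := fun i => 1 / τ α β ξ₀ ξ₁ (n + 1) *
        (d₀ α β ξ₀ i * d₁ α β ξ₁ n - d₁ α β ξ₁ i * d₀ α β ξ₀ n))
      (u := 1 / τ α β ξ₀ ξ₁ (n + 1) * d₁ α β ξ₁ n) (v := 1 / τ α β ξ₀ ξ₁ (n + 1) * d₀ α β ξ₀ n)
      (fun i => by
        rw [← neg_eq_iff_eq_neg.2 (hτ n), e₀, e₀, e₁, e₁]; field_simp; ring)
      (by rw [← neg_eq_iff_eq_neg.2 (hτ n), e₁]; field_simp)
      (by rw [← neg_eq_iff_eq_neg.2 (hτ n), e₀]; field_simp)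
    ext a
    rw [hI]
    fin_cases a <;>
      simp [eval_finsetSum, Matrix.det_fin_two_of, PI, Finset.mul_sum, mul_assoc]
  · obtain ⟨n, rfl⟩ := Nat.exists_eq_add_of_le' hn
    have hII := congrArg (eval x) (h.typeII_mul_det n)
    simp only [eval_add, eval_sub, eval_mul, eval_C] at hII
    have hT := hτ0 n
    rw [one_div, eq_inv_mul_iff_mul_eq₀ (by simpa using hT)]
    simp only [Nat.add_sub_cancel, show n + 2 - 1 = n + 1 by omega, Matrix.det_fin_three,
      Matrix.of_apply, Matrix.cons_val', Matrix.cons_val_zero, Matrix.cons_val_one,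
      Matrix.cons_val, hτ, e₀, e₁, P]
    linear_combination -hII
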